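/- Let $\mathbb{T}^2=(\mathbb{R}/\mathbb{Z})^2$ be the two-dimensional torus, obtained from $[0,1]\times[0,1]$ by identifying opposite sides, and let $m$ be Lebesgue measure on $\mathbb{T}^2$, normalised so that $m(\mathbb{T}^2)=1$. For a real number $c>0$ let $f$ be the skew-product with singularities on the circle $\{x=1/2\}$ given, for $(x,y)\in[0,1)\times[0,1)$ with $x\neq 1/2$, by $$f(x,y)=\left(2x-\lfloor 2x\rfloor,\; y+\frac{c}{|x-1/2|}-\left\lfloor y+\frac{c}{|x-1/2|}\right\rfloor\right).$$ For $n\ge 0$ and $A\subseteq\mathbb{T}^2$ let $f^{-n}(A)$ be the set of points whose first $n$ iterates under $f$ are defined and whose $n$-th iterate lies in $A$. Then: (i) for every $c>0$, $f$ preserves $m$: $f$ is measurable and $m(f^{-1}(A))=m(A)$ for every Lebesgue measurable set $A\subseteq\mathbb{T}^2$; (ii) if $c>1/4$, then $f$ is mixing with respect to $m$: for all Lebesgue measurable sets $A,B\subseteq\mathbb{T}^2$, $$\lim_{n\to\infty}m\big(f^{-n}(A)\cap B\big)=m(A)\,m(B).$$ -/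

import Mathlib

open MeasureTheory Filter Topology

noncomputable section

namespace SkewProduct

/-- The two-dimensional torus `𝕋² = (ℝ/ℤ) × (ℝ/ℤ)`. Its `volume` is the product of the two Haar
measures of total mass one, i.e. Lebesgue measure. -/
abbrev Torus : Type := UnitAddCircle × UnitAddCircle

/-- The representative in `[0, 1)` of a point of the circle `ℝ/ℤ`. -/
def rep (x : UnitAddCircle) : ℝ := (AddCircle.equivIco (1 : ℝ) 0 x : ℝ)

/-- The formula of the skew-product on the unit square, with `⌊·⌋` the integer part; it is used
only where `x ≠ 1/2`. -/
def formula (c : ℝ) (x y : ℝ) : ℝ × ℝ :=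
  (2 * x - (⌊2 * x⌋ : ℝ), y + c / |x - 1 / 2| - (⌊y + c / |x - 1 / 2|⌋ : ℝ))

/-- The skew-product with singularities, as a partial map of the torus: it is defined exactly
off the circle `x = 1/2`. -/
def skew (c : ℝ) : Torus →. Torus := fun p =>
  ⟨rep p.1 ≠ 1 / 2, fun _ =>
    (((formula c (rep p.1) (rep p.2)).1 : UnitAddCircle),
      ((formula c (rep p.1) (rep p.2)).2 : UnitAddCircle))⟩

/-- The preimage `f⁻ⁿ(A)` under the `n`-th iterate of a partial map `f`: the set of all points
whose first `n` iterates are defined and whose `n`-th iterate lies in `A`. -/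
def iterPreimage {X : Type*} (f : X →. X) (n : ℕ) (A : Set X) : Set X := f.preimage^[n] A

/-- The partial map `f` preserves the measure `μ`: `f` is measurable, both for the given
σ-algebra and for its `μ`-completion, and `μ (f⁻¹(A)) = μ A` for every measurable set `A`
(of the completion). For `A = X` this says that `f` is defined almost everywhere when
`μ` is finite. -/
structure Preserves {X : Type*} [MeasurableSpace X] (f : X →. X) (μ : Measure X) : Prop where
  measurableSet_preimage : ∀ A : Set X, MeasurableSet A → MeasurableSet (f.preimage A)
  nullMeasurableSet_preimage : ∀ A : Set X, NullMeasurableSet A μ →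
    NullMeasurableSet (f.preimage A) μ
  measure_preimage : ∀ A : Set X, NullMeasurableSet A μ → μ (f.preimage A) = μ A

/-- The partial map `f` is mixing with respect to `μ`: `μ` is an `f`-invariant probability measure
and `μ (f⁻ⁿ(A) ∩ B) → μ A * μ B` for all sets `A`, `B` of the `μ`-completed σ-algebra. -/
structure Mixing {X : Type*} [MeasurableSpace X] (f : X →. X) (μ : Measure X) : Prop where
  isProbabilityMeasure : IsProbabilityMeasure μ
  preserves : Preserves f μ
  tendsto : ∀ A B : Set X, NullMeasurableSet A μ → NullMeasurableSet B μ →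
    Tendsto (fun n : ℕ => μ (iterPreimage f n A ∩ B)) atTop (𝓝 (μ A * μ B))

end SkewProduct

end

noncomputable section

namespace SkewProduct

/-! On functions `v ⊗ e_l`, with Fourier mode `l` in the fibre, composition with the map is dual to
a transfer operator of the doubling map whose branches carry the phases `cis (K / (1 - x))` and `cis
(K / x)`, where `K = -4πlc` (`integral_totalSkew_mul_tensor`). Since characters span a dense
subspace of L¹, mixing follows once the iterates `v_n` of each nontrivial character tend to zero
uniformly.

For `l = 0` the operator halves even frequencies and kills odd ones. For `l ≠ 0` the iterates share
one modulus of continuity (`Tame.transfer`) and their sup norms decrease to some `a`. The doubling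
map spreads every small interval over the whole circle, so a dip of `‖v_n‖` near one point would
later lower the sup norm below `a`; hence `‖v_n x‖ → a` at every point (`tendsto_norm_iterate`). Two
numbers of norm close to `a` have an average of norm close to `a` only if they nearly agree, so the
two branches are asymptotically in phase (`tendsto_branches`).

Chaining two such relations gives `v_{n+1}(1/2 - t/2) ≈ cis (K (1/t + 1/(1-t))) v_n(1/2 - t/4)`
(`tendsto_near_half`). As `t → 0` both points tend to `1/2` while the phase winds forever. Values of
`t` with phase `1` and with phase `-1` together make `v_n(1/2)` arbitrarily small, so `a = 0`. -/

/-! ### Unimodular phases -/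

/-- The unimodular number `e^{is}`. -/
def cis (s : ℝ) : ℂ := Complex.exp (s * Complex.I)

theorem norm_cis (s : ℝ) : ‖cis s‖ = 1 := Complex.norm_exp_ofReal_mul_I s

theorem cis_add (s t : ℝ) : cis (s + t) = cis s * cis t := by
  simp [cis, add_mul, Complex.exp_add]

theorem cis_zero : cis 0 = 1 := by simp [cis]

theorem cis_neg_mul (s : ℝ) : cis (-s) * cis s = 1 := by
  rw [← cis_add, neg_add_cancel, cis_zero]

theorem norm_cis_sub_le (s t : ℝ) : ‖cis s - cis t‖ ≤ |s - t| := by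
  have h : cis s - cis t = cis t * (Complex.exp (Complex.I * ((s - t : ℝ) : ℂ)) - 1) := by
    have : cis s = cis t * cis (s - t) := by rw [← cis_add]; congr 1; ring
    rw [this, mul_sub, mul_one, mul_comm Complex.I]
    rfl
  rw [h, norm_mul, norm_cis, one_mul]
  exact Real.norm_exp_I_mul_ofReal_sub_one_le

/-- The exponent 1/2 matters. For the phase `K / x` a Lipschitz bound has weight `1 / (x * y)`,
which averaging over the branches only preserves: a factor 4 from the weight, 1/2 from the distance,
1/2 from the average. With square roots the factor is `2 * (1/√2) * (1/2) < 1`. -/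
theorem norm_cis_sub_le_sqrt (s t : ℝ) : ‖cis s - cis t‖ ≤ 2 * √|s - t| := by
  have h1 := norm_cis_sub_le s t
  have h2 : ‖cis s - cis t‖ ≤ 2 := by
    refine (norm_sub_le _ _).trans ?_
    rw [norm_cis, norm_cis]; norm_num
  have h0 := Real.sqrt_nonneg |s - t|
  have h3 := Real.sq_sqrt (abs_nonneg (s - t))
  rcases le_total 1 √|s - t| with h | h <;> nlinarith

theorem measurable_cis : Measurable cis := by
  unfold cis; fun_prop

/-! ### The twisted transfer operator and an invariant modulus of continuity -/

/-- The transfer operator of the doubling map twisted by the phases of the two branches. -/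
def transfer (K : ℝ) (v : ℝ → ℂ) (x : ℝ) : ℂ :=
  (cis (K / (1 - x)) * v (x / 2) + cis (K / x) * v ((x + 1) / 2)) / 2

/-- The modulus of continuity on `(0, 1)` that is contracted by averaging over branches. -/
def modulus (x y : ℝ) : ℝ :=
  √|x - y| * (16 + 1 / (√x * √y) + 1 / (√(1 - x) * √(1 - y)))

theorem modulus_nonneg (x y : ℝ) : 0 ≤ modulus x y := by unfold modulus; positivity

theorem one_div_sqrt_mul_sqrt_le_one {a b : ℝ} (ha : 1 ≤ a) (hb : 1 ≤ b) :
    1 / (√a * √b) ≤ 1 := by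
  have h1 : 1 ≤ √a := Real.one_le_sqrt.2 ha
  have h2 : 1 ≤ √b := Real.one_le_sqrt.2 hb
  rw [div_le_one (by positivity)]
  nlinarith

theorem one_div_sqrt_half_mul (a b : ℝ) (ha : 0 ≤ a) (hb : 0 ≤ b) :
    1 / (√(a / 2) * √(b / 2)) = 2 * (1 / (√a * √b)) := by
  have h : √(a / 2) * √(b / 2) = √a * √b / 2 := by
    rw [Real.sqrt_div ha, Real.sqrt_div hb, div_mul_div_comm,
      Real.mul_self_sqrt (by norm_num)]
  rw [h, one_div_div]
  ring

theorem modulus_average_le {x y : ℝ} (hx : x ∈ Set.Ioo (0 : ℝ) 1) (hy : y ∈ Set.Ioo (0 : ℝ) 1) :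
    modulus (x / 2) (y / 2) + modulus ((x + 1) / 2) ((y + 1) / 2) ≤ 8 / 5 * modulus x y := by
  obtain ⟨hx0, hx1⟩ := hx
  obtain ⟨hy0, hy1⟩ := hy
  have e1 : |x / 2 - y / 2| = |x - y| / 2 := by
    rw [← sub_div, abs_div, abs_two]
  have e2 : |(x + 1) / 2 - (y + 1) / 2| = |x - y| / 2 := by
    rw [← sub_div, abs_div, abs_two]; congr 2; ring
  have e3 : ∀ z : ℝ, 1 - z / 2 = (2 - z) / 2 := fun z => by ring
  have e4 : ∀ z : ℝ, 1 - (z + 1) / 2 = (1 - z) / 2 := fun z => by ring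
  unfold modulus
  rw [e1, e2, e3, e3, e4, e4, one_div_sqrt_half_mul _ _ hx0.le hy0.le,
    one_div_sqrt_half_mul _ _ (by linarith) (by linarith),
    one_div_sqrt_half_mul _ _ (by linarith) (by linarith),
    one_div_sqrt_half_mul _ _ (by linarith) (by linarith)]
  have b1 := one_div_sqrt_mul_sqrt_le_one (a := 2 - x) (b := 2 - y) (by linarith) (by linarith)
  have b2 := one_div_sqrt_mul_sqrt_le_one (a := x + 1) (b := y + 1) (by linarith) (by linarith)
  have hV1 : 0 ≤ 1 / (√x * √y) := by positivity
  have hV2 : 0 ≤ 1 / (√(1 - x) * √(1 - y)) := by positivity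
  -- `0.71` is just above `1/√2`. The constant `16` in `modulus` is chosen so that `0.71 * 36 ≤ 8/5
  -- * 16`, and `0.71 * 2 ≤ 8/5` handles the singular terms.
  have hd : √(|x - y| / 2) ≤ 0.71 * √|x - y| := by
    rw [Real.sqrt_le_left (by positivity), mul_pow, Real.sq_sqrt (abs_nonneg _)]
    nlinarith [abs_nonneg (x - y)]
  have hs : 0 ≤ √|x - y| := Real.sqrt_nonneg _
  set V1 := 1 / (√x * √y)
  set V2 := 1 / (√(1 - x) * √(1 - y))
  set b1' := 1 / (√(2 - x) * √(2 - y))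
  set b2' := 1 / (√(x + 1) * √(y + 1))
  calc _ = √(|x - y| / 2) * (32 + 2 * V1 + 2 * V2 + 2 * b1' + 2 * b2') := by ring
    _ ≤ √(|x - y| / 2) * (36 + 2 * V1 + 2 * V2) :=
      mul_le_mul_of_nonneg_left (by linarith) (Real.sqrt_nonneg _)
    _ ≤ 0.71 * √|x - y| * (36 + 2 * V1 + 2 * V2) := by gcongr
    _ = √|x - y| * (0.71 * (36 + 2 * V1 + 2 * V2)) := by ring
    _ ≤ √|x - y| * (8 / 5 * (16 + V1 + V2)) := mul_le_mul_of_nonneg_left (by linarith) hs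
    _ = _ := by ring

theorem norm_cis_div_sub_le (K : ℝ) {x y : ℝ} (hx : 0 < x) (hy : 0 < y) :
    ‖cis (K / x) - cis (K / y)‖ ≤ 2 * √|K| * (√|x - y| * (1 / (√x * √y))) := by
  refine (norm_cis_sub_le_sqrt _ _).trans (le_of_eq ?_)
  have : |K / x - K / y| = |K| * |x - y| / (x * y) := by
    rw [div_sub_div _ _ hx.ne' hy.ne', abs_div, abs_of_pos (mul_pos hx hy), ← abs_mul,
      ← abs_neg]
    congr 2; ring
  rw [this, Real.sqrt_div (by positivity), Real.sqrt_mul (abs_nonneg _), Real.sqrt_mul hx.le]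
  ring

/-- Functions bounded by `1` on `(0, 1)` with modulus of continuity `C * modulus`. -/
structure Tame (C : ℝ) (v : ℝ → ℂ) : Prop where
  norm_le : ∀ x ∈ Set.Ioo (0 : ℝ) 1, ‖v x‖ ≤ 1
  norm_sub_le : ∀ x ∈ Set.Ioo (0 : ℝ) 1, ∀ y ∈ Set.Ioo (0 : ℝ) 1,
    ‖v x - v y‖ ≤ C * modulus x y

theorem half_mem {x : ℝ} (hx : x ∈ Set.Ioo (0 : ℝ) 1) : x / 2 ∈ Set.Ioo (0 : ℝ) 1 :=
  ⟨by linarith [hx.1], by linarith [hx.2]⟩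

theorem half_add_mem {x : ℝ} (hx : x ∈ Set.Ioo (0 : ℝ) 1) : (x + 1) / 2 ∈ Set.Ioo (0 : ℝ) 1 :=
  ⟨by linarith [hx.1], by linarith [hx.2]⟩

theorem norm_transfer_le (K : ℝ) (v : ℝ → ℂ) (x : ℝ) :
    ‖transfer K v x‖ ≤ (‖v (x / 2)‖ + ‖v ((x + 1) / 2)‖) / 2 := by
  unfold transfer
  rw [norm_div, Complex.norm_two]
  gcongr
  refine (norm_add_le _ _).trans ?_
  rw [norm_mul, norm_mul, norm_cis, norm_cis, one_mul, one_mul]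

theorem norm_transfer_le_of_le {K M : ℝ} {v : ℝ → ℂ}
    (h : ∀ x ∈ Set.Ioo (0 : ℝ) 1, ‖v x‖ ≤ M) :
    ∀ x ∈ Set.Ioo (0 : ℝ) 1, ‖transfer K v x‖ ≤ M := fun x hx => by
  linarith [norm_transfer_le K v x, h _ (half_mem hx), h _ (half_add_mem hx)]

theorem norm_mul_sub_mul_le {a b z w : ℂ} (hb : ‖b‖ = 1) (hz : ‖z‖ ≤ 1) :
    ‖a * z - b * w‖ ≤ ‖a - b‖ + ‖z - w‖ := by
  have : a * z - b * w = (a - b) * z + b * (z - w) := by ring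
  rw [this]
  refine (norm_add_le _ _).trans ?_
  rw [norm_mul, norm_mul, hb, one_mul]
  nlinarith [norm_nonneg (a - b)]

/-- Averaging the branches turns the constant `C` into `4/5 * C` and the variation of the phases
adds `√|K|`; the sum is at most `C` exactly when `5 * √|K| ≤ C`. -/
theorem Tame.transfer {K C : ℝ} {v : ℝ → ℂ} (hC : 5 * √|K| ≤ C) (hv : Tame C v) :
    Tame C (transfer K v) := by
  refine ⟨norm_transfer_le_of_le hv.norm_le, fun x hx y hy => ?_⟩
  have h1 := norm_cis_div_sub_le K hx.1 hy.1
  have h2 := norm_cis_div_sub_le K (sub_pos.2 hx.2) (sub_pos.2 hy.2)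
  rw [show 1 - x - (1 - y) = -(x - y) by ring, abs_neg] at h2
  have h3 := hv.norm_sub_le _ (half_mem hx) _ (half_mem hy)
  have h4 := hv.norm_sub_le _ (half_add_mem hx) _ (half_add_mem hy)
  have h5 := modulus_average_le hx hy
  have hK : 0 ≤ √|K| := Real.sqrt_nonneg _
  have hC0 : 0 ≤ C := by linarith
  have h6 : √|x - y| * (1 / (√x * √y)) + √|x - y| * (1 / (√(1 - x) * √(1 - y)))
      ≤ modulus x y := by
    unfold modulus; nlinarith [Real.sqrt_nonneg |x - y|]
  have p1 := norm_mul_sub_mul_le (a := cis (K / (1 - x))) (w := v (y / 2))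
    (norm_cis (K / (1 - y))) (hv.norm_le _ (half_mem hx))
  have p2 := norm_mul_sub_mul_le (a := cis (K / x)) (w := v ((y + 1) / 2))
    (norm_cis (K / y)) (hv.norm_le _ (half_add_mem hx))
  have h7 : ‖SkewProduct.transfer K v x - SkewProduct.transfer K v y‖ ≤
      (‖cis (K / (1 - x)) * v (x / 2) - cis (K / (1 - y)) * v (y / 2)‖ +
        ‖cis (K / x) * v ((x + 1) / 2) - cis (K / y) * v ((y + 1) / 2)‖) / 2 := by
    unfold SkewProduct.transfer
    rw [← sub_div, norm_div, Complex.norm_two, add_sub_add_comm]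
    gcongr
    exact norm_add_le _ _
  have h8 := mul_le_mul_of_nonneg_left h5 hC0
  have h9 := mul_le_mul_of_nonneg_left h6 hK
  have h10 := mul_le_mul_of_nonneg_right hC (modulus_nonneg x y)
  nlinarith

theorem Tame.iterate {K C : ℝ} {v : ℝ → ℂ} (hC : 5 * √|K| ≤ C) (hv : Tame C v) (n : ℕ) :
    Tame C ((SkewProduct.transfer K)^[n] v) := by
  induction n with
  | zero => exact hv
  | succ n ih => rw [Function.iterate_succ_apply']; exact ih.transfer hC

/-! ### Sup norms of the iterates and pointwise convergence of the norms -/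

/-- Each step doubles the interval on which `v` is small and halves the gain `M - b`, because one of
the two averaged values is small. Once the radius reaches 1 the interval covers `(0, 1)`. The centre
ranges over the closed interval because doubling can send it to an endpoint. -/
theorem norm_iterate_transfer_le {K M : ℝ} (m : ℕ) : ∀ {v : ℝ → ℂ} {b x₀ r : ℝ}, b ≤ M →
    x₀ ∈ Set.Icc (0 : ℝ) 1 → 1 ≤ 2 ^ m * r → (∀ x ∈ Set.Ioo (0 : ℝ) 1, ‖v x‖ ≤ M) →
    (∀ x ∈ Set.Ioo (0 : ℝ) 1, |x - x₀| < r → ‖v x‖ ≤ b) →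
    ∀ x ∈ Set.Ioo (0 : ℝ) 1, ‖(transfer K)^[m] v x‖ ≤ M - (M - b) / 2 ^ m := by
  induction m with
  | zero =>
    intro v b x₀ r _ hx₀ hr _ hb x hx
    have := hb x hx (by
      rw [abs_lt]; constructor <;> linarith [hx.1, hx.2, hx₀.1, hx₀.2])
    simpa using this
  | succ m ih =>
    intro v b x₀ r hbM hx₀ hr hM hb x hx
    rw [Function.iterate_succ_apply]
    have key : ∃ x₁ ∈ Set.Icc (0 : ℝ) 1, ∀ x ∈ Set.Ioo (0 : ℝ) 1, |x - x₁| < 2 * r →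
        ‖transfer K v x‖ ≤ (M + b) / 2 := by
      rcases le_total x₀ (1 / 2) with h | h
      · refine ⟨2 * x₀, ⟨by linarith [hx₀.1], by linarith⟩, fun x hx hxr => ?_⟩
        have h1 := hb _ (half_mem hx) (by
          rw [abs_lt] at hxr ⊢; constructor <;> linarith [hxr.1, hxr.2])
        linarith [norm_transfer_le K v x, hM _ (half_add_mem hx)]
      · refine ⟨2 * x₀ - 1, ⟨by linarith, by linarith [hx₀.2]⟩, fun x hx hxr => ?_⟩
        have h1 := hb _ (half_add_mem hx) (by
          rw [abs_lt] at hxr ⊢; constructor <;> linarith [hxr.1, hxr.2])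
        linarith [norm_transfer_le K v x, hM _ (half_mem hx)]
    obtain ⟨x₁, hx₁, h1⟩ := key
    have h2 := ih (by linarith) hx₁ (by rw [pow_succ] at hr; linarith)
      (norm_transfer_le_of_le (K := K) hM) h1 x hx
    refine h2.trans (le_of_eq ?_)
    rw [pow_succ]
    field_simp
    ring

theorem tendsto_modulus {x₀ : ℝ} (hx₀ : x₀ ∈ Set.Ioo (0 : ℝ) 1) :
    Tendsto (fun x => modulus x x₀) (𝓝 x₀) (𝓝 0) := by
  have h1 : √x₀ * √x₀ ≠ 0 := by
    rw [Real.mul_self_sqrt hx₀.1.le]; exact hx₀.1.ne'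
  have h2 : √(1 - x₀) * √(1 - x₀) ≠ 0 := by
    rw [Real.mul_self_sqrt (by linarith [hx₀.2])]; linarith [hx₀.2]
  have : ContinuousAt (fun x => modulus x x₀) x₀ := by
    unfold modulus
    refine ContinuousAt.mul (by fun_prop) (ContinuousAt.add (ContinuousAt.add (by fun_prop) ?_) ?_)
    · exact ContinuousAt.div (by fun_prop) (by fun_prop) h1
    · exact ContinuousAt.div (by fun_prop) (by fun_prop) h2
  simpa [ContinuousAt, modulus] using this

/-- The supremum of the norm on `(0, 1)`. -/
def supNorm (v : ℝ → ℂ) : ℝ := ⨆ x : Set.Ioo (0 : ℝ) 1, ‖v x‖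

theorem supNorm_le {v : ℝ → ℂ} {M : ℝ} (h : ∀ x ∈ Set.Ioo (0 : ℝ) 1, ‖v x‖ ≤ M) :
    supNorm v ≤ M :=
  haveI : Nonempty (Set.Ioo (0 : ℝ) 1) := ⟨⟨1 / 2, by norm_num⟩⟩
  ciSup_le fun x => h x x.2

theorem le_supNorm {v : ℝ → ℂ} {M : ℝ} (h : ∀ x ∈ Set.Ioo (0 : ℝ) 1, ‖v x‖ ≤ M)
    {x : ℝ} (hx : x ∈ Set.Ioo (0 : ℝ) 1) : ‖v x‖ ≤ supNorm v :=
  le_ciSup (f := fun x : Set.Ioo (0 : ℝ) 1 => ‖v x‖)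
    ⟨M, by rintro _ ⟨y, rfl⟩; exact h y y.2⟩ ⟨x, hx⟩

theorem exists_tendsto_supNorm {K C : ℝ} {v : ℝ → ℂ} (hC : 5 * √|K| ≤ C) (hv : Tame C v) :
    ∃ a : ℝ, Tendsto (fun n => supNorm ((transfer K)^[n] v)) atTop (𝓝 a) ∧
      ∀ n, a ≤ supNorm ((transfer K)^[n] v) := by
  have hanti : Antitone fun n => supNorm ((transfer K)^[n] v) := by
    refine antitone_nat_of_succ_le fun n => supNorm_le fun x hx => ?_
    rw [Function.iterate_succ_apply']
    exact norm_transfer_le_of_le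
      (fun y hy => le_supNorm (hv.iterate hC n).norm_le hy) x hx
  have hbdd : BddBelow (Set.range fun n => supNorm ((transfer K)^[n] v)) := by
    refine ⟨0, ?_⟩
    rintro _ ⟨n, rfl⟩
    exact (norm_nonneg _).trans
      (le_supNorm (hv.iterate hC n).norm_le (x := 1 / 2) (by norm_num))
  exact ⟨_, tendsto_atTop_ciInf hanti hbdd, fun n => ciInf_le hbdd n⟩

theorem tendsto_norm_iterate {K C a : ℝ} {v : ℝ → ℂ} (hC : 5 * √|K| ≤ C) (hv : Tame C v)
    (ha : Tendsto (fun n => supNorm ((transfer K)^[n] v)) atTop (𝓝 a))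
    (hle : ∀ n, a ≤ supNorm ((transfer K)^[n] v)) {x₀ : ℝ} (hx₀ : x₀ ∈ Set.Ioo (0 : ℝ) 1) :
    Tendsto (fun n => ‖(transfer K)^[n] v x₀‖) atTop (𝓝 a) := by
  refine tendsto_order.2 ⟨fun b hb => ?_, fun b hb => ?_⟩
  swap
  · filter_upwards [(tendsto_order.1 ha).2 b hb] with n hn
    exact (le_supNorm (hv.iterate hC n).norm_le hx₀).trans_lt hn
  set ε := (a - b) / 2 with hε
  have hεpos : 0 < ε := by rw [hε]; linarith
  have h1 : ∀ᶠ x in 𝓝 x₀, C * modulus x x₀ < ε := by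
    have := (tendsto_modulus hx₀).const_mul C
    rw [mul_zero] at this
    exact (tendsto_order.1 this).2 ε hεpos
  obtain ⟨r, hr, h2⟩ := Metric.eventually_nhds_iff.1 h1
  obtain ⟨m, hm⟩ : ∃ m : ℕ, 1 ≤ 2 ^ m * r := by
    obtain ⟨m, hm⟩ := pow_unbounded_of_one_lt (1 / r) (one_lt_two : (1 : ℝ) < 2)
    exact ⟨m, by rw [div_lt_iff₀ hr] at hm; exact hm.le⟩
  have hpos : 0 < ε / 2 ^ m := by positivity
  -- `m` depends only on the common modulus of continuity, not on `n`. A dip at time `n` costs the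
  -- sup norm at least `ε / 2 ^ m` by time `m + n`, more than its excess over `a`.
  filter_upwards [(tendsto_order.1 ha).2 (a + ε / 2 ^ m) (by linarith)] with n hn
  by_contra! hcon
  have h3 : ∀ x ∈ Set.Ioo (0 : ℝ) 1, |x - x₀| < r → ‖(transfer K)^[n] v x‖ ≤ a - ε := by
    intro x hx hxr
    have h4 := h2 (y := x) (by rwa [Real.dist_eq])
    have h5 := (hv.iterate hC n).norm_sub_le x hx x₀ hx₀
    have h6 := norm_le_norm_add_norm_sub' ((transfer K)^[n] v x) ((transfer K)^[n] v x₀)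
    linarith
  have h7 := norm_iterate_transfer_le (K := K) m (by linarith [hle n])
    ⟨hx₀.1.le, hx₀.2.le⟩ hm
    (fun x hx => le_supNorm (hv.iterate hC n).norm_le hx) h3
  have h8 : a ≤ supNorm ((transfer K)^[n] v) -
      (supNorm ((transfer K)^[n] v) - (a - ε)) / 2 ^ m := by
    refine (hle (m + n)).trans (supNorm_le ?_)
    rw [Function.iterate_add_apply]
    exact h7
  have h9 : ε / 2 ^ m ≤ (supNorm ((transfer K)^[n] v) - (a - ε)) / 2 ^ m := by
    gcongr; linarith [hle n]
  linarith

/-! ### Phase alignment of the branches and vanishing of the limit -/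

theorem tendsto_sub_of_norm {a : ℝ} {A B : ℕ → ℂ} (hA : Tendsto (fun n => ‖A n‖) atTop (𝓝 a))
    (hB : Tendsto (fun n => ‖B n‖) atTop (𝓝 a))
    (hAB : Tendsto (fun n => ‖(A n + B n) / 2‖) atTop (𝓝 a)) :
    Tendsto (fun n => A n - B n) atTop (𝓝 0) := by
  rw [tendsto_zero_iff_norm_tendsto_zero]
  have h : Tendsto (fun n => √(2 * ‖A n‖ ^ 2 + 2 * ‖B n‖ ^ 2 - 4 * ‖(A n + B n) / 2‖ ^ 2)) atTop
      (𝓝 √(2 * a ^ 2 + 2 * a ^ 2 - 4 * a ^ 2)) :=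
    ((((hA.pow 2).const_mul 2).add ((hB.pow 2).const_mul 2)).sub ((hAB.pow 2).const_mul 4)).sqrt
  rw [show 2 * a ^ 2 + 2 * a ^ 2 - 4 * a ^ 2 = 0 by ring, Real.sqrt_zero] at h
  refine h.congr fun n => ?_
  have := parallelogram_law_with_norm ℝ (A n) (B n)
  rw [norm_div, Complex.norm_two, ← Real.sqrt_sq (norm_nonneg (A n - B n))]
  congr 1
  linear_combination -this

theorem tendsto_branches {K C a : ℝ} {v : ℝ → ℂ} (hC : 5 * √|K| ≤ C) (hv : Tame C v)
    (ha : Tendsto (fun n => supNorm ((transfer K)^[n] v)) atTop (𝓝 a))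
    (hle : ∀ n, a ≤ supNorm ((transfer K)^[n] v)) {x : ℝ} (hx : x ∈ Set.Ioo (0 : ℝ) 1) :
    Tendsto (fun n => cis (K / (1 - x)) * (transfer K)^[n] v (x / 2) -
      cis (K / x) * (transfer K)^[n] v ((x + 1) / 2)) atTop (𝓝 0) := by
  refine tendsto_sub_of_norm (a := a) ?_ ?_ ?_
  · simpa [norm_cis] using tendsto_norm_iterate hC hv ha hle (half_mem hx)
  · simpa [norm_cis] using tendsto_norm_iterate hC hv ha hle (half_add_mem hx)
  · have := (tendsto_norm_iterate hC hv ha hle hx).comp (tendsto_add_atTop_nat 1)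
    refine this.congr fun n => ?_
    rw [Function.comp_apply, Function.iterate_succ_apply']
    rfl

theorem tendsto_succ_sub_branch {K C a : ℝ} {v : ℝ → ℂ} (hC : 5 * √|K| ≤ C) (hv : Tame C v)
    (ha : Tendsto (fun n => supNorm ((transfer K)^[n] v)) atTop (𝓝 a))
    (hle : ∀ n, a ≤ supNorm ((transfer K)^[n] v)) {x : ℝ} (hx : x ∈ Set.Ioo (0 : ℝ) 1) :
    Tendsto (fun n => (transfer K)^[n + 1] v x -
      cis (K / (1 - x)) * (transfer K)^[n] v (x / 2)) atTop (𝓝 0) := by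
  have := (tendsto_branches hC hv ha hle hx).const_mul (-1 / 2 : ℂ)
  rw [mul_zero] at this
  refine this.congr fun n => ?_
  rw [Function.iterate_succ_apply', transfer]
  ring

/-- Alignment at `1 - t` compares the values at `1/2 - t/2` and `1 - t/2`; one more step from `1 -
t/2` along the left branch leads to `1/2 - t/4`. The phases `-K/t`, `K/(1-t)` and `2K/t` add up to
the one stated. -/
theorem tendsto_near_half {K C a : ℝ} {v : ℝ → ℂ} (hC : 5 * √|K| ≤ C) (hv : Tame C v)
    (ha : Tendsto (fun n => supNorm ((transfer K)^[n] v)) atTop (𝓝 a))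
    (hle : ∀ n, a ≤ supNorm ((transfer K)^[n] v)) {t : ℝ} (ht : t ∈ Set.Ioo (0 : ℝ) 1) :
    Tendsto (fun n => (transfer K)^[n + 1] v (1 / 2 - t / 2) -
      cis (K * (1 / t + 1 / (1 - t))) * (transfer K)^[n] v (1 / 2 - t / 4)) atTop (𝓝 0) := by
  have hz : 1 - t / 2 ∈ Set.Ioo (0 : ℝ) 1 := ⟨by linarith [ht.2], by linarith [ht.1]⟩
  have hx : 1 - t ∈ Set.Ioo (0 : ℝ) 1 := ⟨by linarith [ht.2], by linarith [ht.1]⟩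
  have h1 := (tendsto_branches hC hv ha hle hx).comp (tendsto_add_atTop_nat 1)
  have h2 := tendsto_succ_sub_branch hC hv ha hle hz
  have h3 := (h1.const_mul (cis (-(K / t)))).add
    (h2.const_mul (cis (-(K / t)) * cis (K / (1 - t))))
  rw [mul_zero, mul_zero, add_zero] at h3
  refine h3.congr fun n => ?_
  have e1 : (1 - t + 1) / 2 = 1 - t / 2 := by ring
  have e2 : (1 - t / 2) / 2 = 1 / 2 - t / 4 := by ring
  have e3 : (1 - t) / 2 = 1 / 2 - t / 2 := by ring
  have e4 : 1 - (1 - t) = t := by ring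
  have e5 : K / (1 - (1 - t / 2)) = K / t + K / t := by
    have := ht.1.ne'
    rw [show 1 - (1 - t / 2) = t / 2 by ring]; field_simp; norm_num
  have e6 : K * (1 / t + 1 / (1 - t)) = K / t + K / (1 - t) := by ring
  simp only [Function.comp_apply]
  rw [e1, e2, e3, e4, e5, e6, cis_add, cis_add]
  have := cis_neg_mul (K / t)
  linear_combination ((transfer K)^[n + 1] v (1 / 2 - t / 2) -
    cis (K / (1 - t)) * cis (K / t) * (transfer K)^[n] v (1 / 2 - t / 4)) * this

theorem exists_small_phase {p : ℝ → Prop} (hp : ∀ᶠ t in 𝓝[>] (0 : ℝ), p t) :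
    ∀ᶠ s in atTop, ∃ t ∈ Set.Ioo (0 : ℝ) 1, p t ∧ 1 / t + 1 / (1 - t) = s := by
  obtain ⟨u, hu, hup⟩ := mem_nhdsGT_iff_exists_Ioo_subset.1 hp
  have hu0 : (0 : ℝ) < u := hu
  set w := min (u / 2) (1 / 2) with hw
  have hw0 : 0 < w := by positivity
  have hwu : w < u := (min_le_left _ _).trans_lt (by linarith)
  have hw1 : w ≤ 1 / 2 := min_le_right _ _
  filter_upwards [eventually_ge_atTop (1 / w + 1 / (1 - w)),
    eventually_gt_atTop (1 / w)] with s hs hsw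
  have hs0 : 0 < s := lt_trans (by positivity) hsw
  have hsw' : 1 / s ≤ w := by
    rw [div_le_iff₀ hs0]; rw [div_lt_iff₀ hw0] at hsw; linarith
  have hs1 : 0 < 1 / s := by positivity
  have hcont : ContinuousOn (fun t : ℝ => 1 / t + 1 / (1 - t)) (Set.Icc (1 / s) w) := by
    refine ContinuousOn.add (ContinuousOn.div (by fun_prop) (by fun_prop) ?_)
      (ContinuousOn.div (by fun_prop) (by fun_prop) ?_)
    · intro t ht; exact (hs1.trans_le ht.1).ne'
    · intro t ht; linarith [ht.2]
  -- At the left end `t = 1/s` the function is `s + 1 / (1 - 1/s) ≥ s`.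
  obtain ⟨t, ht, hts⟩ := intermediate_value_Icc' hsw' hcont (show s ∈ Set.Icc _ _ from
    ⟨hs, by
      have : 0 ≤ 1 / (1 - 1 / s) := by apply div_nonneg <;> linarith
      simpa using this⟩)
  have ht0 : 0 < t := hs1.trans_le ht.1
  exact ⟨t, ⟨ht0, by linarith [ht.2]⟩, hup ⟨ht0, ht.2.trans_lt hwu⟩, hts⟩

theorem cis_nat_mul_two_pi (N : ℕ) : cis (2 * Real.pi * N) = 1 := by
  unfold cis
  rw [Complex.exp_eq_one_iff]
  exact ⟨N, by push_cast; ring⟩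

theorem cis_neg_nat_mul_two_pi (N : ℕ) : cis (-(2 * Real.pi * N)) = 1 := by
  have := cis_neg_mul (2 * Real.pi * N)
  rwa [cis_nat_mul_two_pi, mul_one] at this

theorem cis_pi : cis Real.pi = -1 := Complex.exp_pi_mul_I

theorem cis_neg_pi : cis (-Real.pi) = -1 := by
  have := cis_neg_mul Real.pi
  rw [cis_pi] at this
  linear_combination -this

theorem exists_phases {K : ℝ} (hK : K ≠ 0) {p : ℝ → Prop} (hp : ∀ᶠ t in 𝓝[>] (0 : ℝ), p t) :
    (∃ t ∈ Set.Ioo (0 : ℝ) 1, p t ∧ cis (K * (1 / t + 1 / (1 - t))) = 1) ∧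
      ∃ t ∈ Set.Ioo (0 : ℝ) 1, p t ∧ cis (K * (1 / t + 1 / (1 - t))) = -1 := by
  have hK' : 0 < |K| := abs_pos.2 hK
  have h := exists_small_phase hp
  have hN : Tendsto (fun N : ℕ => 2 * Real.pi * N / |K|) atTop atTop :=
    (tendsto_natCast_atTop_atTop.const_mul_atTop (by positivity)).atTop_div_const hK'
  have hN' : Tendsto (fun N : ℕ => (2 * Real.pi * N + Real.pi) / |K|) atTop atTop :=
    (tendsto_atTop_add_const_right _ _
      (tendsto_natCast_atTop_atTop.const_mul_atTop (by positivity))).atTop_div_const hK'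
  obtain ⟨N, t, ht, hpt, hs⟩ := (hN.eventually h).exists
  obtain ⟨N', t', ht', hpt', hs'⟩ := (hN'.eventually h).exists
  refine ⟨⟨t, ht, hpt, ?_⟩, ⟨t', ht', hpt', ?_⟩⟩
  · rw [hs]
    rcases abs_choice K with e | e
    · rw [e, mul_div_cancel₀ _ hK, cis_nat_mul_two_pi]
    · rw [e, div_neg, mul_neg, mul_div_cancel₀ _ hK, cis_neg_nat_mul_two_pi]
  · rw [hs']
    rcases abs_choice K with e | e
    · rw [e, mul_div_cancel₀ _ hK, cis_add, cis_nat_mul_two_pi, cis_pi, one_mul]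
    · rw [e, div_neg, mul_neg, mul_div_cancel₀ _ hK, neg_add, cis_add, cis_neg_nat_mul_two_pi,
        cis_neg_pi, one_mul]

theorem tendsto_supNorm_iterate_zero {K C : ℝ} (hK : K ≠ 0) {v : ℝ → ℂ} (hC : 5 * √|K| ≤ C)
    (hv : Tame C v) :
    Tendsto (fun n => supNorm ((transfer K)^[n] v)) atTop (𝓝 0) := by
  obtain ⟨a, ha, hle⟩ := exists_tendsto_supNorm hC hv
  have hhalf : (1 / 2 : ℝ) ∈ Set.Ioo (0 : ℝ) 1 := by norm_num
  have hlim := tendsto_norm_iterate hC hv ha hle hhalf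
  have ha0 : 0 ≤ a := ge_of_tendsto' hlim fun n => norm_nonneg _
  suffices h : ∀ ε > 0, a ≤ ε by
    rwa [le_antisymm (le_of_forall_gt_imp_ge_of_dense fun ε hε => h ε hε) ha0] at ha
  intro ε hε
  have hmod : ∀ᶠ x in 𝓝 (1 / 2 : ℝ), C * modulus x (1 / 2) < ε / 2 := by
    have := (tendsto_modulus hhalf).const_mul C
    rw [mul_zero] at this
    exact (tendsto_order.1 this).2 _ (by positivity)
  have hc2 : ∀ d : ℝ, Tendsto (fun t : ℝ => 1 / 2 - t / d) (𝓝[>] 0) (𝓝 (1 / 2)) := by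
    intro d
    have : ContinuousAt (fun t : ℝ => 1 / 2 - t / d) 0 := by fun_prop
    have h2 := this.tendsto
    simp only [zero_div, sub_zero] at h2
    exact h2.mono_left nhdsWithin_le_nhds
  have hp := ((hc2 2).eventually hmod).and ((hc2 4).eventually hmod)
  obtain ⟨⟨t, ht, ⟨hpt, hpt'⟩, hphase⟩, ⟨u, hu, ⟨hpu, hpu'⟩, hphase'⟩⟩ := exists_phases hK hp
  have h1 := tendsto_near_half hC hv ha hle ht
  have h2 := tendsto_near_half hC hv ha hle hu
  rw [hphase] at h1
  rw [hphase'] at h2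
  have hmem : ∀ t ∈ Set.Ioo (0 : ℝ) 1, 1 / 2 - t / 2 ∈ Set.Ioo (0 : ℝ) 1 ∧
      1 / 2 - t / 4 ∈ Set.Ioo (0 : ℝ) 1 := fun t ht =>
    ⟨⟨by linarith [ht.2], by linarith [ht.1]⟩, ⟨by linarith [ht.2], by linarith [ht.1]⟩⟩
  have h3 := (h2.sub h1).norm
  rw [sub_zero, norm_zero] at h3
  have h4 : ∀ n, 2 * ‖(transfer K)^[n] v (1 / 2)‖ - 2 * ε ≤
      ‖((transfer K)^[n + 1] v (1 / 2 - u / 2) - -1 * (transfer K)^[n] v (1 / 2 - u / 4)) -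
        ((transfer K)^[n + 1] v (1 / 2 - t / 2) - 1 * (transfer K)^[n] v (1 / 2 - t / 4))‖ := by
    intro n
    have g1 := (hv.iterate hC (n + 1)).norm_sub_le _ (hmem u hu).1 _ hhalf
    have g2 := (hv.iterate hC n).norm_sub_le _ (hmem u hu).2 _ hhalf
    have g3 := (hv.iterate hC (n + 1)).norm_sub_le _ (hmem t ht).1 _ hhalf
    have g4 := (hv.iterate hC n).norm_sub_le _ (hmem t ht).2 _ hhalf
    set p := (transfer K)^[n] v (1 / 2)
    set q := (transfer K)^[n + 1] v (1 / 2)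
    set p1 := (transfer K)^[n] v (1 / 2 - u / 4)
    set p2 := (transfer K)^[n] v (1 / 2 - t / 4)
    set q1 := (transfer K)^[n + 1] v (1 / 2 - u / 2)
    set q2 := (transfer K)^[n + 1] v (1 / 2 - t / 2)
    -- The values `q` at time `n + 1` cancel between the relations with phases `-1` and `1`, while
    -- `p` is doubled. Each of the four remaining differences is below `ε / 2`.
    have e : 2 * p =
        ((q1 - -1 * p1) - (q2 - 1 * p2)) - (q1 - q) - (p1 - p) + (q2 - q) - (p2 - p) := by
      ring
    have e' : 2 * ‖p‖ = ‖2 * p‖ := by rw [norm_mul, Complex.norm_two]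
    rw [e', e]
    have k1 := norm_sub_le (((q1 - -1 * p1) - (q2 - 1 * p2)) - (q1 - q) - (p1 - p) + (q2 - q))
      (p2 - p)
    have k2 := norm_add_le (((q1 - -1 * p1) - (q2 - 1 * p2)) - (q1 - q) - (p1 - p)) (q2 - q)
    have k3 := norm_sub_le (((q1 - -1 * p1) - (q2 - 1 * p2)) - (q1 - q)) (p1 - p)
    have k4 := norm_sub_le ((q1 - -1 * p1) - (q2 - 1 * p2)) (q1 - q)
    linarith
  have h5 := le_of_tendsto_of_tendsto' ((hlim.const_mul 2).sub_const (2 * ε)) h3 h4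
  linarith

/-! ### Coordinates on the circle and the branches of doubling -/

theorem isProbabilityMeasure_circle : IsProbabilityMeasure (volume : Measure UnitAddCircle) :=
  ⟨by simp⟩

theorem isProbabilityMeasure_torus : IsProbabilityMeasure (volume : Measure Torus) :=
  haveI := isProbabilityMeasure_circle
  inferInstanceAs (IsProbabilityMeasure ((volume : Measure UnitAddCircle).prod volume))

attribute [local instance] isProbabilityMeasure_torus

theorem rep_mem (x : UnitAddCircle) : rep x ∈ Set.Ico (0 : ℝ) 1 := by
  have h := (AddCircle.equivIco (1 : ℝ) 0 x).2
  exact ⟨h.1, h.2.trans_eq (zero_add 1)⟩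

theorem coe_rep (x : UnitAddCircle) : ((rep x : ℝ) : UnitAddCircle) = x :=
  AddCircle.coe_equivIco

theorem rep_coe {t : ℝ} (ht : t ∈ Set.Ico (0 : ℝ) 1) : rep (t : UnitAddCircle) = t :=
  AddCircle.equivIco_coe_of_mem (by rwa [zero_add])

theorem measurable_rep : Measurable rep :=
  measurable_subtype_coe.comp (AddCircle.measurableEquivIco (1 : ℝ) 0).measurable

/-- The point `1/2` of the circle. -/
def halfPoint : UnitAddCircle := ((1 / 2 : ℝ) : UnitAddCircle)

theorem coe_one_eq_zero : ((1 : ℝ) : UnitAddCircle) = 0 := AddCircle.coe_period 1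

theorem two_nsmul_halfPoint : 2 • halfPoint = 0 := by
  rw [halfPoint, ← AddCircle.coe_nsmul, ← coe_one_eq_zero]
  norm_num

theorem rep_branches (x : UnitAddCircle) :
    (rep x = rep (2 • x) / 2 ∧ rep (x + halfPoint) = (rep (2 • x) + 1) / 2) ∨
      (rep x = (rep (2 • x) + 1) / 2 ∧ rep (x + halfPoint) = rep (2 • x) / 2) := by
  have hx := rep_mem x
  generalize hr : rep x = r at hx
  have hxr : x = (r : UnitAddCircle) := by rw [← hr, coe_rep]
  rcases lt_or_ge r (1 / 2) with h | h
  · left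
    have h2 : rep (2 • x) = 2 * r := by
      rw [hxr, ← AddCircle.coe_nsmul, nsmul_eq_mul, Nat.cast_two]
      exact rep_coe ⟨by linarith [hx.1], by linarith⟩
    have h3 : rep (x + halfPoint) = r + 1 / 2 := by
      rw [hxr, halfPoint, ← AddCircle.coe_add]
      exact rep_coe ⟨by linarith [hx.1], by linarith⟩
    rw [h2, h3]
    constructor <;> ring
  · right
    have h2 : rep (2 • x) = 2 * r - 1 := by
      have : 2 • x = ((2 * r - 1 : ℝ) : UnitAddCircle) := by
        rw [AddCircle.coe_sub, coe_one_eq_zero, sub_zero, hxr, ← AddCircle.coe_nsmul,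
          nsmul_eq_mul, Nat.cast_two]
      rw [this]
      exact rep_coe ⟨by linarith, by linarith [hx.2]⟩
    have h3 : rep (x + halfPoint) = r - 1 / 2 := by
      have : x + halfPoint = ((r - 1 / 2 : ℝ) : UnitAddCircle) := by
        have h1 : ((1 / 2 : ℝ) : UnitAddCircle) + ((1 / 2 : ℝ) : UnitAddCircle) = 0 := by
          rw [← AddCircle.coe_add, ← coe_one_eq_zero]; norm_num
        rw [AddCircle.coe_sub, hxr, halfPoint, eq_sub_iff_add_eq, add_assoc, h1, add_zero]
      rw [this]
      exact rep_coe ⟨by linarith, by linarith [hx.2]⟩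
    rw [h2, h3]
    constructor <;> ring

/-! ### The skew-product as a measure-preserving map, and its deck involution -/

/-- The rotation of the fibre over `x`. -/
def rotation (c : ℝ) (x : UnitAddCircle) : UnitAddCircle :=
  ((c / |rep x - 1 / 2| : ℝ) : UnitAddCircle)

theorem measurable_rotation (c : ℝ) : Measurable (rotation c) := by
  refine AddCircle.measurable_mk'.comp (Measurable.div measurable_const ?_)
  exact (measurable_rep.sub_const _).abs

/-- The skew-product, extended to a map defined on all of the torus. -/
def totalSkew (c : ℝ) (p : Torus) : Torus := (2 • p.1, p.2 + rotation c p.1)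

/-- The involution exchanging the two preimages of a point under the skew-product. -/
def deck (c : ℝ) (p : Torus) : Torus :=
  (p.1 + halfPoint, p.2 + (rotation c p.1 - rotation c (p.1 + halfPoint)))

theorem totalSkew_deck (c : ℝ) (p : Torus) : totalSkew c (deck c p) = totalSkew c p := by
  refine Prod.ext ?_ ?_
  · change 2 • (p.1 + halfPoint) = 2 • p.1
    rw [nsmul_add, two_nsmul_halfPoint, add_zero]
  · change p.2 + (rotation c p.1 - rotation c (p.1 + halfPoint)) + rotation c (p.1 + halfPoint) =
      p.2 + rotation c p.1
    abel

theorem measurePreserving_fibre_rotation {f g : UnitAddCircle → UnitAddCircle}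
    (hf : MeasurePreserving f) (hg : Measurable g) :
    MeasurePreserving (fun p : Torus => (f p.1, p.2 + g p.1)) := by
  refine hf.skew_product (g := fun x y => y + g x) ?_ (ae_of_all _ fun x => ?_)
  · exact measurable_snd.add (hg.comp measurable_fst)
  · exact (measurePreserving_add_right volume (g x)).map_eq

theorem measurePreserving_totalSkew (c : ℝ) : MeasurePreserving (totalSkew c) :=
  measurePreserving_fibre_rotation (AddCircle.ergodic_nsmul one_lt_two).toMeasurePreserving
    (measurable_rotation c)

theorem measurePreserving_deck (c : ℝ) : MeasurePreserving (deck c) :=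
  measurePreserving_fibre_rotation (f := fun x => x + halfPoint)
    (measurePreserving_add_right volume halfPoint)
    ((measurable_rotation c).sub ((measurable_rotation c).comp (measurable_add_const halfPoint)))

theorem ae_fst_ne (a : UnitAddCircle) : ∀ᵐ p : Torus, p.1 ≠ a := by
  have h0 : (volume : Measure UnitAddCircle) {a} = 0 := by
    rw [← Metric.closedBall_zero, AddCircle.volume_closedBall]
    simp
  have h : ∀ᵐ x : UnitAddCircle, x ≠ a := by
    rw [ae_iff]; simpa using h0
  exact Measure.quasiMeasurePreserving_fst.ae h

/-! ### Duality with the transfer operator on Fourier modes -/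

/-- The function `v ⊗ e_l` on the torus. -/
def tensor (v : ℝ → ℂ) (l : ℤ) (p : Torus) : ℂ := v (rep p.1) * fourier l p.2

theorem measurable_tensor {v : ℝ → ℂ} (hv : Measurable v) (l : ℤ) : Measurable (tensor v l) :=
  (hv.comp (measurable_rep.comp measurable_fst)).mul
    ((fourier l).continuous.measurable.comp measurable_snd)

theorem norm_fourier (l : ℤ) (x : UnitAddCircle) : ‖fourier l x‖ = 1 := by
  rw [fourier_apply]; exact Circle.norm_coe _

theorem norm_tensor (v : ℝ → ℂ) (l : ℤ) (p : Torus) : ‖tensor v l p‖ = ‖v (rep p.1)‖ := by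
  rw [tensor, norm_mul, norm_fourier, mul_one]

theorem fourier_apply_add (l : ℤ) (x y : UnitAddCircle) :
    fourier l (x + y) = fourier l x * fourier l y := by
  simp only [fourier_apply, smul_add, AddCircle.toCircle_add, Circle.coe_mul]

theorem fourier_coe_eq_cis (l : ℤ) (t : ℝ) :
    fourier l (t : UnitAddCircle) = cis (2 * Real.pi * l * t) := by
  rw [fourier_coe_apply, cis]
  congr 1
  push_cast
  ring

theorem fourier_neg_rotation (c : ℝ) (l : ℤ) (x : UnitAddCircle) :
    fourier l (-rotation c x) = cis (-(2 * Real.pi * l * c) / |rep x - 1 / 2|) := by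
  rw [rotation, ← AddCircle.coe_neg, fourier_coe_eq_cis]
  congr 1
  ring

theorem tensor_add_tensor_deck (c : ℝ) (v : ℝ → ℂ) (l : ℤ) (p : Torus) :
    tensor v l p + tensor v l (deck c p) =
      2 * tensor (transfer (-(4 * Real.pi * l * c)) v) l (totalSkew c p) := by
  have e0 : ∀ s : ℝ, s ∈ Set.Ico (0 : ℝ) 1 →
      -(2 * Real.pi * l * c) / |s / 2 - 1 / 2| = -(4 * Real.pi * l * c) / (1 - s) := by
    intro s hs
    have h : 0 < 1 - s := by linarith [hs.2]
    rw [show s / 2 - 1 / 2 = -((1 - s) / 2) by ring, abs_neg, abs_of_pos (by positivity)]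
    field_simp
    ring
  -- At `s = 0` both sides are divisions by zero, hence `0`; the identity therefore holds at every
  -- point, the singular circle included.
  have e1 : ∀ s : ℝ, s ∈ Set.Ico (0 : ℝ) 1 →
      -(2 * Real.pi * l * c) / |(s + 1) / 2 - 1 / 2| = -(4 * Real.pi * l * c) / s := by
    intro s hs
    rw [show (s + 1) / 2 - 1 / 2 = s / 2 by ring, abs_of_nonneg (by linarith [hs.1])]
    rw [div_div_eq_mul_div]
    congr 1
    ring
  have hs := rep_mem (2 • p.1)
  have f1 := fourier_neg_rotation c l p.1
  have f2 := fourier_neg_rotation c l (p.1 + halfPoint)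
  have g1 : fourier l p.2 = fourier l (p.2 + rotation c p.1) * fourier l (-rotation c p.1) := by
    rw [← fourier_apply_add, add_neg_cancel_right]
  have g2 : fourier l (p.2 + (rotation c p.1 - rotation c (p.1 + halfPoint))) =
      fourier l (p.2 + rotation c p.1) * fourier l (-rotation c (p.1 + halfPoint)) := by
    rw [← fourier_apply_add]; congr 1; abel
  simp only [tensor, totalSkew, deck, transfer]
  rw [g1, g2, f1, f2]
  rcases rep_branches p.1 with ⟨h1, h2⟩ | ⟨h1, h2⟩
  · rw [h1, h2, e0 _ hs, e1 _ hs]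
    ring
  · rw [h1, h2, e0 _ hs, e1 _ hs]
    ring

theorem measurable_transfer {K : ℝ} {v : ℝ → ℂ} (hv : Measurable v) :
    Measurable (transfer K v) := by
  have h1 : Measurable fun x : ℝ => cis (K / (1 - x)) :=
    measurable_cis.comp (measurable_const.div (measurable_const.sub measurable_id))
  have h2 : Measurable fun x : ℝ => cis (K / x) :=
    measurable_cis.comp (measurable_const.div measurable_id)
  have h3 : Measurable fun x : ℝ => v (x / 2) := hv.comp (by fun_prop)
  have h4 : Measurable fun x : ℝ => v ((x + 1) / 2) := hv.comp (by fun_prop)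
  exact ((h1.mul h3).add (h2.mul h4)).div_const 2

theorem norm_transfer_le_one {K : ℝ} {v : ℝ → ℂ} (hv : ∀ x, ‖v x‖ ≤ 1) (x : ℝ) :
    ‖transfer K v x‖ ≤ 1 := by
  linarith [norm_transfer_le K v x, hv (x / 2), hv ((x + 1) / 2)]

theorem integral_comp_of_measurePreserving {X : Type*} [MeasurableSpace X] {μ : Measure X}
    {T : X → X} (hT : MeasurePreserving T μ μ) {φ : X → ℂ} (hφ : Measurable φ) :
    ∫ p, φ (T p) ∂μ = ∫ p, φ p ∂μ := by
  conv_rhs => rw [← hT.map_eq]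
  rw [integral_map hT.measurable.aemeasurable hφ.aestronglyMeasurable]

/-- The deck involution preserves the measure and fixes `φ ∘ totalSkew c`, so the tensor may be
averaged over the two preimages of a point. The average factors through `totalSkew c`, whose
invariance then removes it. -/
theorem integral_totalSkew_mul_tensor (c : ℝ) {φ : Torus → ℂ} (hφ : Measurable φ)
    (hφ1 : ∀ p, ‖φ p‖ ≤ 1) {v : ℝ → ℂ} (hv : Measurable v) (hv1 : ∀ x, ‖v x‖ ≤ 1) (l : ℤ) :
    ∫ p, φ (totalSkew c p) * tensor v l p =
      ∫ p, φ p * tensor (transfer (-(4 * Real.pi * l * c)) v) l p := by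
  have hF := measurePreserving_totalSkew c
  have hH := measurePreserving_deck c
  have hm : Measurable fun p => φ (totalSkew c p) * tensor v l p :=
    (hφ.comp hF.measurable).mul (measurable_tensor hv l)
  have hi : Integrable fun p => φ (totalSkew c p) * tensor v l p := by
    refine Integrable.of_bound hm.aestronglyMeasurable 1 (ae_of_all _ fun p => ?_)
    rw [norm_mul, norm_tensor]
    exact mul_le_one₀ (hφ1 _) (norm_nonneg _) (hv1 _)
  have hi' : Integrable fun p => φ (totalSkew c (deck c p)) * tensor v l (deck c p) :=
    hH.integrable_comp_of_integrable hi
  have h1 := integral_comp_of_measurePreserving hH hm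
  have h2 : ∫ p, 2 * (φ (totalSkew c p) *
      tensor (transfer (-(4 * Real.pi * l * c)) v) l (totalSkew c p)) =
      (∫ p, φ (totalSkew c p) * tensor v l p) +
        ∫ p, φ (totalSkew c (deck c p)) * tensor v l (deck c p) := by
    rw [← integral_add hi hi']
    congr 1
    funext p
    rw [totalSkew_deck]
    linear_combination -φ (totalSkew c p) * tensor_add_tensor_deck c v l p
  have h3 := integral_comp_of_measurePreserving hF
    (hφ.mul (measurable_tensor (measurable_transfer (K := -(4 * Real.pi * l * c)) hv) l))
  simp only [Pi.mul_apply] at h3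
  rw [integral_const_mul, h1, h3] at h2
  linear_combination -h2 / 2

theorem integral_iterate_mul_tensor (c : ℝ) {φ : Torus → ℂ} (hφ : Measurable φ)
    (hφ1 : ∀ p, ‖φ p‖ ≤ 1) (l : ℤ) (n : ℕ) : ∀ {v : ℝ → ℂ}, Measurable v → (∀ x, ‖v x‖ ≤ 1) →
    ∫ p, φ ((totalSkew c)^[n] p) * tensor v l p =
      ∫ p, φ p * tensor ((transfer (-(4 * Real.pi * l * c)))^[n] v) l p := by
  induction n with
  | zero => intro v _ _; rfl
  | succ n ih =>
    intro v hv hv1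
    simp only [Function.iterate_succ_apply]
    rw [← ih (measurable_transfer hv) (norm_transfer_le_one hv1)]
    exact integral_totalSkew_mul_tensor c (φ := fun p => φ ((totalSkew c)^[n] p))
      (hφ.comp ((measurePreserving_totalSkew c).iterate n).measurable) (fun p => hφ1 _) hv hv1 l

theorem norm_integral_mul_tensor_le {φ : Torus → ℂ} (hφ1 : ∀ p, ‖φ p‖ ≤ 1) {v : ℝ → ℂ}
    (hv1 : ∀ x, ‖v x‖ ≤ 1) (l : ℤ) : ‖∫ p, φ p * tensor v l p‖ ≤ supNorm v := by
  have h := norm_integral_le_of_norm_le_const (μ := (volume : Measure Torus)) (C := supNorm v)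
    (f := fun p => φ p * tensor v l p) (by
      -- `supNorm` does not see the endpoint `0`, which is a null circle.
      filter_upwards [ae_fst_ne 0] with p hp
      have h0 : rep p.1 ∈ Set.Ioo (0 : ℝ) 1 := by
        refine ⟨lt_of_le_of_ne (rep_mem p.1).1 fun h => hp ?_, (rep_mem p.1).2⟩
        rw [← coe_rep p.1, ← h, AddCircle.coe_zero]
      rw [norm_mul, norm_tensor]
      have h1 := le_supNorm (fun x _ => hv1 x) h0
      nlinarith [hφ1 p, norm_nonneg (φ p), norm_nonneg (v (rep p.1))])
  simpa using h

/-! ### Decay of correlations against characters -/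

/-- The exponential `e_j` as a function on the line. -/
def wave (j : ℤ) (x : ℝ) : ℂ := cis (2 * Real.pi * j * x)

theorem measurable_wave (j : ℤ) : Measurable (wave j) :=
  measurable_cis.comp (by fun_prop)

theorem wave_rep (j : ℤ) (x : UnitAddCircle) : wave j (rep x) = fourier j x := by
  rw [wave, ← fourier_coe_eq_cis, coe_rep]

theorem tame_wave (K : ℝ) (j : ℤ) : Tame (5 * √|K| + 2 * Real.pi * |(j : ℝ)|) (wave j) := by
  refine ⟨fun x _ => (norm_cis _).le, fun x hx y hy => ?_⟩
  refine (norm_cis_sub_le _ _).trans ?_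
  have e : |2 * Real.pi * j * x - 2 * Real.pi * j * y| = 2 * Real.pi * |(j : ℝ)| * |x - y| := by
    rw [← mul_sub, abs_mul, abs_mul, abs_of_pos Real.two_pi_pos]
  have h1 : |x - y| ≤ modulus x y := by
    have hxy : |x - y| ≤ 1 := by
      rw [abs_le]; constructor <;> linarith [hx.1, hx.2, hy.1, hy.2]
    have h2 : |x - y| ≤ √|x - y| := by
      rw [Real.le_sqrt (abs_nonneg _) (abs_nonneg _)]
      nlinarith [abs_nonneg (x - y)]
    have h3 : 0 ≤ 1 / (√x * √y) := by positivity
    have h4 : 0 ≤ 1 / (√(1 - x) * √(1 - y)) := by positivity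
    unfold modulus
    nlinarith [Real.sqrt_nonneg |x - y|]
  rw [e]
  have h5 : 0 ≤ √|K| * modulus x y := mul_nonneg (Real.sqrt_nonneg _) (modulus_nonneg x y)
  have h6 : 2 * Real.pi * |(j : ℝ)| * |x - y| ≤ 2 * Real.pi * |(j : ℝ)| * modulus x y := by
    gcongr
  linarith

theorem transfer_zero_fun (K : ℝ) (n : ℕ) : (transfer K)^[n] 0 = 0 := by
  induction n with
  | zero => rfl
  | succ n ih =>
    rw [Function.iterate_succ_apply', ih]
    funext x
    simp [transfer]

theorem cis_int_mul_pi (j : ℤ) : cis (Real.pi * j) = (-1) ^ j := by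
  rw [← cis_pi, cis, cis, ← Complex.exp_int_mul]
  congr 1
  push_cast
  ring

theorem transfer_zero_wave (j : ℤ) (x : ℝ) :
    transfer 0 (wave j) x = cis (Real.pi * j * x) * (1 + (-1) ^ j) / 2 := by
  have e1 : 2 * Real.pi * j * (x / 2) = Real.pi * j * x := by ring
  have e2 : 2 * Real.pi * j * ((x + 1) / 2) = Real.pi * j * x + Real.pi * j := by ring
  rw [transfer, wave, wave, zero_div, zero_div, cis_zero, e1, e2, cis_add, cis_int_mul_pi]
  ring

/-- A nonzero frequency can be halved only finitely often before it becomes odd, and then the two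
branches cancel. -/
theorem iterate_transfer_zero_wave (m : ℕ) : ∀ j : ℤ, j ≠ 0 → j.natAbs ≤ m → ∀ n ≥ m,
    (transfer 0)^[n] (wave j) = 0 := by
  induction m with
  | zero => intro j hj h; omega
  | succ m ih =>
    intro j hj hjm n hn
    obtain ⟨n, rfl⟩ : ∃ k, n = k + 1 := ⟨n - 1, by omega⟩
    rw [Function.iterate_succ_apply]
    rcases Int.even_or_odd' j with ⟨i, rfl | rfl⟩
    · have : transfer 0 (wave (2 * i)) = wave i := by
        funext x
        rw [transfer_zero_wave, (even_two_mul i).neg_one_zpow, wave]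
        push_cast
        rw [show Real.pi * (2 * i) * x = 2 * Real.pi * i * x by ring]
        ring
      rw [this]
      exact ih i (by omega) (by omega) n (by omega)
    · have : transfer 0 (wave (2 * i + 1)) = 0 := by
        funext x
        rw [transfer_zero_wave, (odd_two_mul_add_one i).neg_one_zpow]
        simp
      rw [this, transfer_zero_fun]

theorem tendsto_supNorm_wave {c : ℝ} (hc : c ≠ 0) {j l : ℤ} (h : ¬(j = 0 ∧ l = 0)) :
    Tendsto (fun n => supNorm ((transfer (-(4 * Real.pi * l * c)))^[n] (wave j))) atTop (𝓝 0) := by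
  by_cases hl : l = 0
  · have hj : j ≠ 0 := fun hj => h ⟨hj, hl⟩
    subst hl
    refine tendsto_const_nhds.congr' ?_
    filter_upwards [eventually_ge_atTop j.natAbs] with n hn
    rw [Int.cast_zero, mul_zero, zero_mul, neg_zero,
      iterate_transfer_zero_wave _ j hj le_rfl n hn]
    simp [supNorm]
  · have hK : -(4 * Real.pi * l * c) ≠ 0 := by
      have : (l : ℝ) ≠ 0 := Int.cast_ne_zero.2 hl
      have := Real.pi_ne_zero
      simp [*]
    exact tendsto_supNorm_iterate_zero hK (by
      have := Real.two_pi_pos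
      have : 0 ≤ 2 * Real.pi * |(j : ℝ)| := by positivity
      linarith) (tame_wave _ j)

theorem tendsto_integral_mul_tensor_wave {c : ℝ} (hc : c ≠ 0) {φ : Torus → ℂ} (hφ : Measurable φ)
    (hφ1 : ∀ p, ‖φ p‖ ≤ 1) {j l : ℤ} (h : ¬(j = 0 ∧ l = 0)) :
    Tendsto (fun n => ∫ p, φ ((totalSkew c)^[n] p) * tensor (wave j) l p) atTop (𝓝 0) := by
  refine squeeze_zero_norm (fun n => ?_) (tendsto_supNorm_wave hc h)
  have hw : ∀ n x, ‖(transfer (-(4 * Real.pi * l * c)))^[n] (wave j) x‖ ≤ 1 := by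
    intro n
    induction n with
    | zero => exact fun x => (norm_cis _).le
    | succ n ih => rw [Function.iterate_succ_apply']; exact norm_transfer_le_one ih
  rw [integral_iterate_mul_tensor c hφ hφ1 l n (measurable_wave j) (hw 0)]
  exact norm_integral_mul_tensor_le hφ1 (hw n) l

/-- For `φ = 1` the correlation does not depend on `n`, so a limit of `0` means that it is `0`. -/
theorem integral_tensor_wave {j l : ℤ} (h : ¬(j = 0 ∧ l = 0)) :
    ∫ p, tensor (wave j) l p = 0 := by
  have := tendsto_integral_mul_tensor_wave (c := 1) one_ne_zero (φ := fun _ => 1)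
    measurable_const (fun _ => by simp) h
  simp only [one_mul] at this
  exact tendsto_nhds_unique tendsto_const_nhds this

/-! ### From the partial map to its total extension, up to null sets -/

theorem preimage_skew (c : ℝ) (A : Set Torus) :
    (skew c).preimage A = {p | rep p.1 ≠ 1 / 2} ∩ totalSkew c ⁻¹' A := by
  ext p
  have hint : ∀ n : ℤ, ((n : ℝ) : UnitAddCircle) = 0 := fun n => by
    have := AddCircle.coe_zsmul (p := (1 : ℝ)) (n := n) (x := (1 : ℝ))
    rwa [coe_one_eq_zero, smul_zero, zsmul_eq_mul, mul_one] at this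
  have h : (((formula c (rep p.1) (rep p.2)).1 : UnitAddCircle),
      ((formula c (rep p.1) (rep p.2)).2 : UnitAddCircle)) = totalSkew c p := by
    refine Prod.ext ?_ ?_
    · simp only [formula, totalSkew]
      rw [AddCircle.coe_sub, hint, sub_zero, ← Nat.cast_two, ← nsmul_eq_mul, AddCircle.coe_nsmul,
        coe_rep]
    · simp only [formula, totalSkew]
      rw [AddCircle.coe_sub, hint, sub_zero, AddCircle.coe_add, coe_rep]
      rfl
  rw [PFun.mem_preimage]
  constructor
  · rintro ⟨q, hq, hd, rfl⟩
    exact ⟨hd, by rw [Set.mem_preimage, ← h]; exact hq⟩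
  · rintro ⟨hd, hq⟩
    exact ⟨_, hq, hd, h⟩

theorem measurableSet_dom : MeasurableSet {p : Torus | rep p.1 ≠ 1 / 2} :=
  (measurable_rep.comp measurable_fst) (measurableSet_singleton (1 / 2)).compl

theorem ae_mem_dom : ∀ᵐ p : Torus, rep p.1 ≠ 1 / 2 := by
  filter_upwards [ae_fst_ne halfPoint] with p hp h
  exact hp (by rw [← coe_rep p.1, h]; rfl)

theorem preimage_skew_ae_eq (c : ℝ) (A : Set Torus) :
    (skew c).preimage A =ᵐ[volume] totalSkew c ⁻¹' A := by
  rw [preimage_skew]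
  exact inter_ae_eq_right_of_ae_eq_univ (eventuallyEq_univ.2 ae_mem_dom)

theorem preserves_skew (c : ℝ) : Preserves (skew c) (volume : Measure Torus) where
  measurableSet_preimage A hA := by
    rw [preimage_skew]
    exact measurableSet_dom.inter ((measurePreserving_totalSkew c).measurable hA)
  nullMeasurableSet_preimage A hA :=
    (hA.preimage (measurePreserving_totalSkew c).quasiMeasurePreserving).congr
      (preimage_skew_ae_eq c A).symm
  measure_preimage A hA := by
    rw [measure_congr (preimage_skew_ae_eq c A),
      (measurePreserving_totalSkew c).measure_preimage hA]

theorem iterPreimage_skew_ae_eq (c : ℝ) {A A' : Set Torus} (hA : A =ᵐ[volume] A') (n : ℕ) :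
    iterPreimage (skew c) n A =ᵐ[volume] (totalSkew c)^[n] ⁻¹' A' := by
  induction n with
  | zero => exact hA
  | succ n ih =>
    rw [iterPreimage, Function.iterate_succ_apply', Function.iterate_succ, Set.preimage_comp]
    exact (preimage_skew_ae_eq c _).trans
      ((measurePreserving_totalSkew c).quasiMeasurePreserving.preimage_ae_eq ih)

/-! ### Density of trigonometric polynomials -/

/-- The character `e_j ⊗ e_l` of the torus. -/
def character (k : ℤ × ℤ) : C(Torus, ℂ) :=
  (fourier k.1).comp ⟨Prod.fst, continuous_fst⟩ * (fourier k.2).comp ⟨Prod.snd, continuous_snd⟩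

theorem character_apply (k : ℤ × ℤ) (p : Torus) :
    character k p = fourier k.1 p.1 * fourier k.2 p.2 := rfl

theorem character_eq_tensor (k : ℤ × ℤ) (p : Torus) :
    character k p = tensor (wave k.1) k.2 p := by
  rw [character_apply, tensor, wave_rep]

/-- The algebra of trigonometric polynomials on the torus. -/
def characterSubalgebra : StarSubalgebra ℂ C(Torus, ℂ) where
  toSubalgebra := Algebra.adjoin ℂ (Set.range character)
  star_mem' := by
    change Algebra.adjoin ℂ (Set.range character) ≤ star (Algebra.adjoin ℂ (Set.range character))
    refine Algebra.adjoin_le ?_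
    rintro - ⟨k, rfl⟩
    refine Algebra.subset_adjoin ⟨-k, ?_⟩
    ext p
    simp only [character_apply, Prod.fst_neg, Prod.snd_neg, fourier_neg, ContinuousMap.star_apply,
      star_mul', RCLike.star_def]

theorem characterSubalgebra_coe :
    Subalgebra.toSubmodule characterSubalgebra.toSubalgebra =
      Submodule.span ℂ (Set.range character) := by
  apply Algebra.adjoin_eq_span_of_subset
  refine Set.Subset.trans ?_ Submodule.subset_span
  intro x hx
  refine Submonoid.closure_induction (fun _ => id) ⟨0, ?_⟩ ?_ hx
  · ext p
    simp [character_apply]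
  · rintro - - - - ⟨m, rfl⟩ ⟨n, rfl⟩
    refine ⟨m + n, ?_⟩
    ext p
    simp only [character_apply, Prod.fst_add, Prod.snd_add, fourier_add, ContinuousMap.mul_apply]
    ring

theorem characterSubalgebra_separatesPoints : characterSubalgebra.SeparatesPoints := by
  intro p q hpq
  have hinj : ∀ x y : UnitAddCircle, fourier 1 x = fourier 1 y → x = y := by
    intro x y h
    rw [fourier_one, fourier_one] at h
    exact AddCircle.injective_toCircle one_ne_zero (Circle.ext h)
  by_cases h : p.1 = q.1
  · refine ⟨_, ⟨character (0, 1), Algebra.subset_adjoin ⟨_, rfl⟩, rfl⟩, fun hc => ?_⟩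
    beta_reduce at hc
    rw [character_apply, character_apply, fourier_zero, fourier_zero, one_mul, one_mul] at hc
    exact hpq (Prod.ext h (hinj _ _ hc))
  · refine ⟨_, ⟨character (1, 0), Algebra.subset_adjoin ⟨_, rfl⟩, rfl⟩, fun hc => ?_⟩
    beta_reduce at hc
    rw [character_apply, character_apply, fourier_zero, fourier_zero, mul_one, mul_one] at hc
    exact h (hinj _ _ hc)

theorem span_character_dense (g : C(Torus, ℂ)) {ε : ℝ} (hε : 0 < ε) :
    ∃ q ∈ Submodule.span ℂ (Set.range character), ‖g - q‖ < ε := by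
  have h := ContinuousMap.starSubalgebra_topologicalClosure_eq_top_of_separatesPoints
    characterSubalgebra characterSubalgebra_separatesPoints
  have hg : g ∈ characterSubalgebra.topologicalClosure := by rw [h]; trivial
  obtain ⟨q, hq, hgq⟩ := Metric.mem_closure_iff.1 hg ε hε
  refine ⟨q, ?_, by rwa [← dist_eq_norm]⟩
  rw [← characterSubalgebra_coe]
  exact hq

theorem exists_span_character_integral_le {f : Torus → ℂ} (hf : Integrable f) {ε : ℝ}
    (hε : 0 < ε) :
    ∃ q ∈ Submodule.span ℂ (Set.range character), ∫ p, ‖f p - q p‖ ≤ ε := by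
  obtain ⟨g, -, hg, hgc, hgi⟩ := hf.exists_hasCompactSupport_integral_sub_le (half_pos hε)
  obtain ⟨q, hq, hgq⟩ := span_character_dense ⟨g, hgc⟩ (half_pos hε)
  refine ⟨q, hq, ?_⟩
  have hqi : Integrable (fun p => q p) :=
    Integrable.of_bound q.continuous.aestronglyMeasurable ‖q‖ (ae_of_all _ q.norm_coe_le_norm)
  have hfg : Integrable (fun p => ‖f p - g p‖) := (hf.sub hgi).norm
  have h1 : ∫ p, ‖f p - q p‖ ≤ ∫ p, (‖f p - g p‖ + ε / 2) := by
    refine integral_mono (hf.sub hqi).norm (hfg.add (integrable_const _)) fun p => ?_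
    have h2 := norm_sub_le_norm_sub_add_norm_sub (f p) (g p) (q p)
    have h3 := (⟨g, hgc⟩ - q : C(Torus, ℂ)).norm_coe_le_norm p
    have h4 : (⟨g, hgc⟩ - q : C(Torus, ℂ)) p = g p - q p := rfl
    rw [h4] at h3
    change ‖f p - q p‖ ≤ ‖f p - g p‖ + ε / 2
    linarith
  rw [integral_add hfg (integrable_const _)] at h1
  simp only [integral_const, probReal_univ, one_smul] at h1
  linarith

/-- The uniform bound on `u n` makes the functionals equicontinuous on L¹, so convergence passes
from the span of the characters to its closure. -/
theorem tendsto_integral_mul_of_characters {u : ℕ → Torus → ℂ} (hu : ∀ n, Measurable (u n))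
    (hu1 : ∀ n p, ‖u n p‖ ≤ 1)
    (h : ∀ k, Tendsto (fun n => ∫ p, u n p * character k p) atTop (𝓝 0))
    {f : Torus → ℂ} (hf : Integrable f) :
    Tendsto (fun n => ∫ p, u n p * f p) atTop (𝓝 0) := by
  have hint : ∀ n, ∀ {g : Torus → ℂ}, Integrable g → Integrable fun p => u n p * g p :=
    fun n g hg => hg.bdd_mul (hu n).aestronglyMeasurable (ae_of_all _ (hu1 n))
  have hcont : ∀ q : C(Torus, ℂ), Integrable fun p => q p := fun q =>
    Integrable.of_bound q.continuous.aestronglyMeasurable ‖q‖ (ae_of_all _ q.norm_coe_le_norm)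
  have hspan : ∀ q ∈ Submodule.span ℂ (Set.range character),
      Tendsto (fun n => ∫ p, u n p * q p) atTop (𝓝 0) := by
    intro q hq
    induction hq using Submodule.span_induction with
    | mem x hx => obtain ⟨k, rfl⟩ := hx; exact h k
    | zero => simp
    | add x y _ _ hx hy =>
      have := hx.add hy
      rw [add_zero] at this
      refine this.congr fun n => ?_
      rw [← integral_add (hint n (hcont x)) (hint n (hcont y))]
      simp only [ContinuousMap.add_apply, mul_add]
    | smul a x _ hx =>
      have := hx.const_mul a
      rw [mul_zero] at this
      refine this.congr fun n => ?_
      rw [← integral_const_mul]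
      simp only [ContinuousMap.smul_apply, smul_eq_mul]
      congr 1
      funext p
      ring
  rw [Metric.tendsto_atTop]
  intro ε hε
  obtain ⟨q, hq, hfq⟩ := exists_span_character_integral_le hf (half_pos hε)
  obtain ⟨N, hN⟩ := Metric.tendsto_atTop.1 (hspan q hq) (ε / 2) (half_pos hε)
  refine ⟨N, fun n hn => ?_⟩
  have h1 := hN n hn
  rw [dist_zero_right] at h1 ⊢
  have hsub : Integrable (fun p => f p - q p) := hf.sub (hcont q)
  have h2 : ∫ p, u n p * f p = (∫ p, u n p * (f p - q p)) + ∫ p, u n p * q p := by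
    rw [← integral_add (hint n hsub) (hint n (hcont q))]
    congr 1
    funext p
    ring
  have h3 : ‖∫ p, u n p * (f p - q p)‖ ≤ ∫ p, ‖f p - q p‖ := by
    refine norm_integral_le_of_norm_le hsub.norm (ae_of_all _ fun p => ?_)
    rw [norm_mul]
    exact mul_le_of_le_one_left (norm_nonneg _) (hu1 n p)
  rw [h2]
  linarith [norm_add_le (∫ p, u n p * (f p - q p)) (∫ p, u n p * q p)]

/-! ### Mixing for sets -/

theorem tendsto_measureReal_inter {c : ℝ} (hc : c ≠ 0) {A B : Set Torus} (hA : MeasurableSet A)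
    (hB : MeasurableSet B) :
    Tendsto (fun n => (volume : Measure Torus).real ((totalSkew c)^[n] ⁻¹' A ∩ B)) atTop
      (𝓝 ((volume : Measure Torus).real A * (volume : Measure Torus).real B)) := by
  set μ : Measure Torus := volume
  set χ : Torus → ℂ := A.indicator 1 with hχ
  have hχm : Measurable χ := measurable_one.indicator hA
  have hχv : ∀ p, χ p = 0 ∨ χ p = 1 := fun p => by
    by_cases hp : p ∈ A <;> simp [hχ, hp]
  have hχ1 : ∀ p, ‖χ p‖ ≤ 1 := fun p => by rcases hχv p with h | h <;> simp [h]
  have hmeas : ∀ n, Measurable ((totalSkew c)^[n]) := fun n =>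
    ((measurePreserving_totalSkew c).iterate n).measurable
  have hindI : ∀ S : Set Torus, MeasurableSet S → Integrable (S.indicator (1 : Torus → ℂ)) μ :=
    fun S hS => (integrable_const (1 : ℂ)).indicator hS
  have hind : ∀ S : Set Torus, MeasurableSet S →
      ∫ p, S.indicator (1 : Torus → ℂ) p ∂μ = (μ.real S : ℂ) := fun S hS => by
    rw [integral_indicator hS]
    simp
  have hA1 : μ.real A ≤ 1 := measureReal_le_one
  have hA0 : 0 ≤ μ.real A := measureReal_nonneg
  -- Subtracting `μ.real A` removes the trivial character and keeps the bound 1, since the values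
  -- are `-μ.real A` and `1 - μ.real A`.
  have key := tendsto_integral_mul_of_characters
    (u := fun n p => χ ((totalSkew c)^[n] p) - (μ.real A : ℂ))
    (fun n => (hχm.comp (hmeas n)).sub_const _)
    (fun n p => by
      rcases hχv ((totalSkew c)^[n] p) with h | h
      · rw [h, zero_sub, norm_neg, Complex.norm_real, Real.norm_of_nonneg hA0]; exact hA1
      · rw [h, ← Complex.ofReal_one, ← Complex.ofReal_sub, Complex.norm_real,
          Real.norm_of_nonneg (by linarith)]
        linarith)
    (fun k => by
      have hki : Integrable (fun p => character k p) μ :=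
        Integrable.of_bound (character k).continuous.aestronglyMeasurable ‖character k‖
          (ae_of_all _ (character k).norm_coe_le_norm)
      have hsplit : ∀ n, ∫ p, (χ ((totalSkew c)^[n] p) - (μ.real A : ℂ)) * character k p ∂μ =
          (∫ p, χ ((totalSkew c)^[n] p) * character k p ∂μ) -
            μ.real A * ∫ p, character k p ∂μ := fun n => by
        have hi : Integrable (fun p => χ ((totalSkew c)^[n] p) * character k p) μ :=
          hki.bdd_mul (hχm.comp (hmeas n)).aestronglyMeasurable
            (ae_of_all _ fun p => hχ1 ((totalSkew c)^[n] p))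
        rw [← integral_const_mul, ← integral_sub hi (hki.const_mul _)]
        simp only [sub_mul]
      refine Tendsto.congr (fun n => (hsplit n).symm) ?_
      by_cases hk : k.1 = 0 ∧ k.2 = 0
      · have hone : ∀ p, character k p = 1 := fun p => by
          rw [character_apply, hk.1, hk.2, fourier_zero, fourier_zero, one_mul]
        refine tendsto_const_nhds.congr fun n => ?_
        simp only [hone, mul_one]
        rw [integral_comp_of_measurePreserving ((measurePreserving_totalSkew c).iterate n) hχm,
          hind A hA]
        simp
      · simp only [character_eq_tensor]
        rw [integral_tensor_wave hk]
        simpa using tendsto_integral_mul_tensor_wave hc hχm hχ1 hk)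
    (hindI B hB)
  have hval : ∀ n, ∫ p, (χ ((totalSkew c)^[n] p) - (μ.real A : ℂ)) *
      B.indicator (1 : Torus → ℂ) p ∂μ =
      ((μ.real ((totalSkew c)^[n] ⁻¹' A ∩ B) - μ.real A * μ.real B : ℝ) : ℂ) := fun n => by
    have hS : MeasurableSet ((totalSkew c)^[n] ⁻¹' A ∩ B) := (hmeas n hA).inter hB
    push_cast
    rw [← hind _ hS, ← hind B hB, ← integral_const_mul,
      ← integral_sub (hindI _ hS) ((hindI B hB).const_mul _)]
    congr 1
    funext p
    by_cases h1 : (totalSkew c)^[n] p ∈ A <;> by_cases h2 : p ∈ B <;> simp [hχ, h1, h2]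
  replace key := key.congr hval
  have h0 : Tendsto (fun n => μ.real ((totalSkew c)^[n] ⁻¹' A ∩ B) - μ.real A * μ.real B) atTop
      (𝓝 0) := by
    rw [← Complex.ofReal_zero] at key
    exact Complex.continuous_re.continuousAt.tendsto.comp key
  exact tendsto_sub_nhds_zero_iff.1 h0

theorem mixing_skew {c : ℝ} (hc : c ≠ 0) : Mixing (skew c) (volume : Measure Torus) where
  isProbabilityMeasure := isProbabilityMeasure_torus
  preserves := preserves_skew c
  tendsto A B hA hB := by
    obtain ⟨A', hA', hAA'⟩ := hA.exists_measurable_superset_ae_eq.imp fun _ h => h.2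
    obtain ⟨B', hB', hBB'⟩ := hB.exists_measurable_superset_ae_eq.imp fun _ h => h.2
    have h1 : ∀ n, (volume : Measure Torus) (iterPreimage (skew c) n A ∩ B) =
        volume ((totalSkew c)^[n] ⁻¹' A' ∩ B') := fun n =>
      measure_congr ((iterPreimage_skew_ae_eq c hAA'.symm n).inter hBB'.symm)
    simp only [h1]
    rw [← measure_congr hAA', ← measure_congr hBB',
      ← ENNReal.tendsto_toReal_iff (fun n => measure_ne_top _ _)
        (ENNReal.mul_ne_top (measure_ne_top _ _) (measure_ne_top _ _)), ENNReal.toReal_mul]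
    exact tendsto_measureReal_inter hc hA' hB'

end SkewProduct

end

theorem theoremB (c : ℝ) (hc : 0 < c) :
    SkewProduct.Preserves (SkewProduct.skew c) (volume : Measure SkewProduct.Torus) ∧
      (1 / 4 < c →
        SkewProduct.Mixing (SkewProduct.skew c) (volume : Measure SkewProduct.Torus)) :=
  ⟨SkewProduct.preserves_skew c, fun _ => SkewProduct.mixing_skew hc.ne'⟩
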